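/- **Lemma 2.** Let $l>0$, $\xi_0\in\mathbb{R}^6$, $C=\mathrm{diag}(EI,EI,GJ,GA,GA,EA)$ with $E,I,G,J,A>0$, let $\mathcal U,\mathcal U^+:SE(3)\to\mathbb{R}$ be smooth, and let $\Lambda_{ad}:\mathbb{R}^n\to\mathbb{R}^6$ be a smooth embedding (an injective immersion that is a homeomorphism onto its image). For $\omega\in\mathbb R^3$ let $\hat\omega$ be the $3\times 3$ matrix of $x\mapsto\omega\times x$. For $\xi=(\omega,v)\in\mathbb{R}^6$ put $\hat\xi=\xi^\wedge=\begin{bmatrix}\hat\omega&v\\0&0\end{bmatrix}$ and $\mathrm{ad}_\xi=\begin{bmatrix}\hat\omega&0\\\hat v&\hat\omega\end{bmatrix}$. For $g\in SE(3)$ define the wrenches $W(g),W_+(g)\in\mathbb{R}^6$ by $\zeta^TW(g)=-D\mathcal U(g)[g\hat\zeta]$ and $\zeta^TW_+(g)=-D\mathcal U^+(g)[g\hat\zeta]$ for all $\zeta\in\mathbb{R}^6$. Give $C^\infty([0,l],SE(3)\times\mathbb{R}^6)$ the topology of uniform convergence of all derivatives and its usual Fréchet manifold structure. For $(g,u)$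 in this space and $\tau\in\mathbb{R}^n$ put $\Lambda=Cu+\Lambda_{ad}(\tau)$ and consider $$g(0)=e,\qquad g'=g(\xi_0+u)^\wedge,\qquad \Lambda'=\mathrm{ad}_{\xi_0+u}^T\Lambda-W(g)\quad\text{on }[0,l].\tag{1}$$ For $(\lambda,\tau)\in\mathbb{R}^6\times\mathbb{R}^n$ such that (1) has a solution on all of $[0,l]$ with $Cu(0)=\lambda$, let $\Psi(\lambda,\tau)=(g,u)$ be this solution, and put $F(\lambda,\tau)=\Lambda(l)-W_+(g(l))$. Let $$\bar{\mathcal A}=\{(\lambda,\tau): \Psi(\lambda,\tau)\text{ is defined},\ F(\lambda,\tau)=0,\ \mathrm{rank}\,F_\lambda(\lambda,\tau)=6\},$$ where $F_\lambda$ is the partial derivative of $F$ in $\lambda$, and let $\bar{\mathcal C}$ be the set of all $(g,u)\in C^\infty([0,l],SE(3)\times\mathbb{R}^6)$ for which there is a $\tau\in\mathbb{R}^n$ such that (1) and $\Lambda(l)=W_+(g(l))$ hold and $\mathrm{rank}\,F_\lambda(Cu(0),\tau)=6$. Then $\Psi$ restricts to a diffeomorphism $\bar{\mathcal A}\to\bar{\mathcal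 C}$: it is a homeomorphism from $\bar{\mathcal A}\subset\mathbb{R}^6\times\mathbb{R}^n$ onto $\bar{\mathcal C}\subset C^\infty([0,l],SE(3)\times\mathbb{R}^6)$, and near each point both $\Psi|_{\bar{\mathcal A}}$ and its inverse extend to a smooth map defined on an open subset of the ambient space. -/

import Mathlib

open Set Topology
open scoped ContDiff Matrix

attribute [local instance] Matrix.normedAddCommGroup Matrix.normedSpace

/-- Twists and wrenches in `ℝ⁶`, angular part first, linear part second. -/
abbrev Vec6 : Type := Fin 3 ⊕ Fin 3 → ℝ

/-- Real `4 × 4` matrices, split into blocks of sizes `3` and `1`. -/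
abbrev Mat4 : Type := Matrix (Fin 3 ⊕ Unit) (Fin 3 ⊕ Unit) ℝ

/-- The skew-symmetric matrix of the cross product with `w`. -/
def hat3 (w : Fin 3 → ℝ) : Matrix (Fin 3) (Fin 3) ℝ :=
  !![0, -w 2, w 1; w 2, 0, -w 0; -w 1, w 0, 0]

/-- The element of `𝔰𝔢(3)` that belongs to the twist `ξ = (ω, v)`. -/
def hat6 (ξ : Vec6) : Mat4 :=
  Matrix.fromBlocks (hat3 fun i => ξ (Sum.inl i))
    (Matrix.replicateCol Unit fun i => ξ (Sum.inr i)) 0 0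

/-- The matrix `ad_ξ` of the twist `ξ = (ω, v)`. -/
def adMatrix (ξ : Vec6) : Matrix (Fin 3 ⊕ Fin 3) (Fin 3 ⊕ Fin 3) ℝ :=
  Matrix.fromBlocks (hat3 fun i => ξ (Sum.inl i)) 0
    (hat3 fun i => ξ (Sum.inr i)) (hat3 fun i => ξ (Sum.inl i))

/-- The group `SE(3)` of rigid motions, as homogeneous matrices. -/
def SE3 : Set Mat4 :=
  {g | ∃ Q ∈ Matrix.specialOrthogonalGroup (Fin 3) ℝ, ∃ p : Fin 3 → ℝ,
    g = Matrix.fromBlocks Q (Matrix.replicateCol Unit p) 0 1}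

theorem one_mem_SE3 : (1 : Mat4) ∈ SE3 := by
  refine ⟨1, one_mem _, 0, ?_⟩
  rw [← Matrix.fromBlocks_one]
  congr 1

/-- The space `C^∞([0, l], SE(3) × ℝ⁶)` of smooth pairs `(g, u)`. Smoothness on the closed
interval is understood with one-sided derivatives at the end points. -/
def ConfigSpace (l : ℝ) (hl : 0 < l) : Type :=
  {q : Icc (0 : ℝ) l → Mat4 × Vec6 //
    ContDiffOn ℝ ∞ (IccExtend hl.le q) (Icc 0 l) ∧ ∀ s, (q s).1 ∈ SE3}

namespace ConfigSpace

variable {l : ℝ} {hl : 0 < l}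

/-- The pair `(g, u)` as a function on the line (constant outside `[0, l]`). -/
noncomputable def curve (q : ConfigSpace l hl) : ℝ → Mat4 × Vec6 := IccExtend hl.le q.1

/-- The frame component `g`. -/
noncomputable def g (q : ConfigSpace l hl) (s : ℝ) : Mat4 := (q.curve s).1

/-- The strain component `u`. -/
noncomputable def u (q : ConfigSpace l hl) (s : ℝ) : Vec6 := (q.curve s).2

instance : Nonempty (ConfigSpace l hl) :=
  ⟨⟨fun _ => (1, 0), contDiffOn_const, fun _ => one_mem_SE3⟩⟩

/-- The smooth topology: uniform convergence on `[0, l]` of the derivatives of every order. -/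
noncomputable instance : TopologicalSpace (ConfigSpace l hl) :=
  ⨅ k : ℕ, TopologicalSpace.induced
    (fun q : ConfigSpace l hl => UniformFun.ofFun
      (fun s : Icc (0 : ℝ) l => iteratedDerivWithin k q.curve (Icc 0 l) (s : ℝ)))
    inferInstance

/-- A family `P` of configurations with parameters in the open set `V` of a normed space is a
smooth map `V → C^∞([0, l], SE(3) × ℝ⁶)` if `(v, s) ↦ P v s` is smooth on `V × [0, l]`
(exponential law). -/
def SmoothFamilyOn {X : Type*} [NormedAddCommGroup X] [NormedSpace ℝ X]
    (V : Set X) (P : X → ConfigSpace l hl) : Prop :=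
  ContDiffOn ℝ ∞ (fun p : X × ℝ => (P p.1).curve p.2) (V ×ˢ Icc 0 l)

/-- Smoothness of a map from an open set `O` of the Fréchet manifold `C^∞([0, l], SE(3) × ℝ⁶)`
to a normed space: the map is smooth along every smooth finite-dimensional family of
configurations in `O`. For Fréchet manifolds this is the usual notion of smoothness. -/
def SmoothOn {Y : Type*} [NormedAddCommGroup Y] [NormedSpace ℝ Y]
    (Φ : ConfigSpace l hl → Y) (O : Set (ConfigSpace l hl)) : Prop :=
  ∀ (m : ℕ) (V : Set (Fin m → ℝ)) (P : (Fin m → ℝ) → ConfigSpace l hl),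
    IsOpen V → SmoothFamilyOn V P → MapsTo P V O → ContDiffOn ℝ ∞ (fun v => Φ (P v)) V

/-- The map `f` restricts to a diffeomorphism from the subset `S` of a normed space onto the
subset `T` of `C^∞([0, l], SE(3) × ℝ⁶)`: it is a homeomorphism from `S` onto `T`, and both it
and its inverse extend, near each point, to a smooth map on an open set of the ambient space. -/
def IsDiffeomorphOn {X : Type*} [NormedAddCommGroup X] [NormedSpace ℝ X]
    (f : X → ConfigSpace l hl) (S : Set X) (T : Set (ConfigSpace l hl)) : Prop :=
  ∃ e : S ≃ₜ T,
    (∀ x : S, (e x : ConfigSpace l hl) = f x) ∧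
    (∀ x : S, ∃ (V : Set X) (P : X → ConfigSpace l hl), IsOpen V ∧ (x : X) ∈ V ∧
      SmoothFamilyOn V P ∧ ∀ y : S, (y : X) ∈ V → P y = e y) ∧
    (∀ q : T, ∃ (O : Set (ConfigSpace l hl)) (Φ : ConfigSpace l hl → X), IsOpen O ∧
      (q : ConfigSpace l hl) ∈ O ∧ SmoothOn Φ O ∧
      ∀ r : T, (r : ConfigSpace l hl) ∈ O → Φ r = e.symm r)

end ConfigSpace

/-- The wrench `W(g)` of a potential `U`, given by `ζᵀ W(g) = -δU` for the variation
`δg = g ζ^`. For `g ∈ SE(3)` the direction `g ζ^` is tangent to `SE(3)`, so that `W(g)` depends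
only on the restriction of `U` to `SE(3)`. -/
noncomputable def potentialWrench (U : Mat4 → ℝ) (g : Mat4) : Vec6 :=
  fun i => -(fderiv ℝ U g (g * hat6 (Pi.single i 1)))

/-- The data of a continuum robot with `n` actuation variables. The smooth potentials on `SE(3)`
are given through smooth extensions to all matrices; these exist because `SE(3)` is a closed
submanifold, and only the values on `SE(3)` matter. -/
structure ContinuumRobot (n : ℕ) where
  /-- Young's modulus -/
  E : ℝ
  /-- shear modulus -/
  G : ℝ
  /-- second moment of area of the cross section -/
  I : ℝ
  /-- polar moment of area of the cross section -/
  J : ℝ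
  /-- area of the cross section -/
  A : ℝ
  /-- length of the backbone -/
  l : ℝ
  E_pos : 0 < E
  G_pos : 0 < G
  I_pos : 0 < I
  J_pos : 0 < J
  A_pos : 0 < A
  l_pos : 0 < l
  /-- natural body twist of the backbone -/
  ξ₀ : Vec6
  /-- potential of the environment -/
  U : Mat4 → ℝ
  U_smooth : ContDiff ℝ ∞ U
  /-- potential of the tip load -/
  Utip : Mat4 → ℝ
  Utip_smooth : ContDiff ℝ ∞ Utip
  /-- actuation wrench as a function of the actuation variables -/
  Λad : (Fin n → ℝ) → Vec6
  Λad_smooth : ContDiff ℝ ∞ Λad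

namespace ContinuumRobot

variable {n : ℕ} (R : ContinuumRobot n)

/-- The smooth pairs `(g, u)` on `[0, l]`. -/
abbrev Config : Type := ConfigSpace R.l R.l_pos

/-- The stiffness matrix `diag(EI, EI, GJ, GA, GA, EA)`. -/
noncomputable def stiffness : Matrix (Fin 3 ⊕ Fin 3) (Fin 3 ⊕ Fin 3) ℝ :=
  Matrix.diagonal (Sum.elim ![R.E * R.I, R.E * R.I, R.G * R.J] ![R.G * R.A, R.G * R.A, R.E * R.A])

/-- The wrench `Λ = C u + Λ_ad(τ)` of the constitutive law. -/
noncomputable def wrench (τ : Fin n → ℝ) (q : R.Config) (s : ℝ) : Vec6 :=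
  R.stiffness *ᵥ q.u s + R.Λad τ

/-- `(g, u)` satisfies the statics equations on `[0, l]` under the actuation `τ`:
`g(0) = e`, `g' = g (ξ₀ + u)^` and `Λ' = ad_ξᵀ Λ - W(g)`, where `ξ = ξ₀ + u` and
`Λ = C u + Λ_ad(τ)`. -/
def IsStatic (τ : Fin n → ℝ) (q : R.Config) : Prop :=
  q.g 0 = 1 ∧ ∀ s ∈ Icc (0 : ℝ) R.l,
    HasDerivWithinAt q.g (q.g s * hat6 (R.ξ₀ + q.u s)) (Icc 0 R.l) s ∧
    HasDerivWithinAt (R.wrench τ q)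
      ((adMatrix (R.ξ₀ + q.u s))ᵀ *ᵥ R.wrench τ q s - potentialWrench R.U (q.g s)) (Icc 0 R.l) s

/-- The boundary condition `Λ(l) = W₊(g(l))`. -/
def TipCondition (τ : Fin n → ℝ) (q : R.Config) : Prop :=
  R.wrench τ q R.l - potentialWrench R.Utip (q.g R.l) = 0

/-- `(g, u)` solves the initial value problem with base wrench `C u(0) = λ` and actuation `τ`,
where `x = (λ, τ)`. -/
def IsShot (x : Vec6 × (Fin n → ℝ)) (q : R.Config) : Prop :=
  R.stiffness *ᵥ q.u 0 = x.1 ∧ R.IsStatic x.2 q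

/-- The pairs `(λ, τ)` for which the initial value problem has a solution on all of `[0, l]`. -/
def shootingDomain : Set (Vec6 × (Fin n → ℝ)) := {x | ∃ q, R.IsShot x q}

/-- The shooting map `Ψ(λ, τ) = (g, u)`, with an irrelevant value outside `shootingDomain`. -/
noncomputable def Ψ (x : Vec6 × (Fin n → ℝ)) : R.Config := Classical.epsilon (R.IsShot x)

/-- The boundary residual `F(λ, τ) = Λ(l) - W₊(g(l))`, where `(g, u) = Ψ(λ, τ)`. -/
noncomputable def F (x : Vec6 × (Fin n → ℝ)) : Vec6 :=
  R.wrench x.2 (R.Ψ x) R.l - potentialWrench R.Utip ((R.Ψ x).g R.l)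

/-- The partial derivative `F_λ(λ, τ)`. -/
noncomputable def Flam (x : Vec6 × (Fin n → ℝ)) : Vec6 →L[ℝ] Vec6 :=
  fderiv ℝ (fun lam : Vec6 => R.F (lam, x.2)) x.1

/-- `F_λ` has rank `6` at `x`. -/
def IsRegular (x : Vec6 × (Fin n → ℝ)) : Prop :=
  Module.finrank ℝ (LinearMap.range (R.Flam x).toLinearMap) = 6

/-- The regular admissible set `𝒜̄` of pairs `(λ, τ)`. -/
def Abar : Set (Vec6 × (Fin n → ℝ)) :=
  {x | x ∈ R.shootingDomain ∧ R.F x = 0 ∧ R.IsRegular x}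

/-- The set `𝒞̄` of configurations `(g, u)` that solve the boundary value problem for some
actuation `τ` and are regular, that is, `F_λ` has rank `6` at `(C u(0), τ)`. -/
def Cbar : Set R.Config :=
  {q | ∃ τ, R.IsStatic τ q ∧ R.TipCondition τ q ∧ R.IsRegular (R.stiffness *ᵥ q.u 0, τ)}

end ContinuumRobot

/-! Injectivity comes from reading `(λ, τ)` off the two ends of the rod: `λ = C u(0)`, and the tip
condition says `Λ_ad(τ) = W₊(g(l)) - C u(l)`, which determines `τ`. These formulas make sense for
every configuration and use only point evaluations and smooth maps. Composed with a local smooth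
left inverse of `Λ_ad`, they extend the inverse of `Ψ` to an open set of configurations.
Surjectivity is uniqueness for the initial value problem; the rank condition is the same on both
sides and is carried along.

Smoothness of `Ψ` is smooth dependence of an ODE on its data. With `τ' = 0` adjoined, parameters
become initial values of one autonomous system (`staticsField`), and `exists_contDiffOn_flow`
applies. Its proof solves `Y = y + s ∫ f(Y)` in `C([0,1], E)` by the implicit function theorem: `Z ↦
f ∘ Z` is smooth, and the derivative in `Y` is the identity minus a Volterra operator, hence
invertible. The factor `s` encodes time, so dependence on data and time is joint. Joint smoothness
over the compact interval then gives continuity in the topology of uniform convergence of all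
derivatives. -/

/-! ### Superposition operators on spaces of continuous functions. -/

section Nemytskii

universe u

variable {K : Type*} [TopologicalSpace K] [CompactSpace K]
  {E F : Type u} [NormedAddCommGroup E] [NormedSpace ℝ E] [NormedAddCommGroup F] [NormedSpace ℝ F]

/-- Pointwise application of a continuous family of operators to a continuous family of vectors. -/
noncomputable def ContinuousMap.pointwiseApply :
    C(K, E →L[ℝ] F) →L[ℝ] C(K, E) →L[ℝ] C(K, F) :=
  LinearMap.mkContinuous₂
    (LinearMap.mk₂ ℝ (fun (A : C(K, E →L[ℝ] F)) (h : C(K, E)) =>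
        (⟨fun s => A s (h s), A.continuous.clm_apply h.continuous⟩ : C(K, F)))
      (fun _ _ _ => by ext; simp) (fun _ _ _ => by ext; simp)
      (fun _ _ _ => by ext; simp) (fun _ _ _ => by ext; simp)) 1
    (fun A h => by
      rw [one_mul]
      refine (ContinuousMap.norm_le _ (mul_nonneg (norm_nonneg A) (norm_nonneg h))).2 fun s => ?_
      exact ((A s).le_opNorm _).trans
        (mul_le_mul (A.norm_coe_le_norm s) (h.norm_coe_le_norm s) (norm_nonneg _) (norm_nonneg A)))

@[simp]
theorem ContinuousMap.pointwiseApply_apply (A : C(K, E →L[ℝ] F)) (h : C(K, E)) (s : K) :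
    ContinuousMap.pointwiseApply A h s = A s (h s) := rfl

theorem ContinuousMap.hasFDerivAt_comp_left (f : C(E, F)) (f' : C(E, E →L[ℝ] F))
    (hf : ∀ x, HasFDerivAt f (f' x) x) (Y : C(K, E)) :
    HasFDerivAt (fun Z : C(K, E) => f.comp Z) (ContinuousMap.pointwiseApply (f'.comp Y)) Y := by
  rw [hasFDerivAt_iff_isLittleO_nhds_zero, Asymptotics.isLittleO_iff]
  intro ε hε
  have hc : ContinuousAt (fun Z : C(K, E) => f'.comp Z) Y :=
    (ContinuousMap.continuous_postcomp f').continuousAt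
  obtain ⟨δ, hδ, H⟩ := (Metric.continuousAt_iff
    (f := fun Z : C(K, E) => f'.comp Z) (a := Y)).1 hc ε hε
  -- One `δ` must serve all `s`. It comes from continuity of `Z ↦ f' ∘ Z` in the sup norm, tested on
  -- `Y` plus the constant `z - Y s`.
  have key : ∀ s : K, ∀ z ∈ Metric.ball (Y s) δ, ‖f' z - f' (Y s)‖ ≤ ε := by
    intro s z hz
    have h1 : dist (Y + ContinuousMap.const K (z - Y s)) Y < δ := by
      rw [dist_eq_norm, add_sub_cancel_left]
      refine ((ContinuousMap.norm_le _ (norm_nonneg _)).2 fun _ => le_rfl).trans_lt ?_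
      exact mem_ball_iff_norm.1 hz
    have h2 := (ContinuousMap.dist_apply_le_dist s).trans_lt (H h1)
    rw [dist_eq_norm] at h2
    simpa using h2.le
  filter_upwards [Metric.ball_mem_nhds (0 : C(K, E)) hδ] with h hh
  refine (ContinuousMap.norm_le _ (by positivity)).2 fun s => ?_
  have hhs : ‖h s‖ ≤ ‖h‖ := h.norm_coe_le_norm s
  rw [mem_ball_zero_iff] at hh
  have := Convex.norm_image_sub_le_of_norm_hasFDerivWithin_le' (f := f) (f' := fun x => f' x)
    (fun x _ => (hf x).hasFDerivWithinAt) (key s) (convex_ball _ _) (Metric.mem_ball_self hδ)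
    (show Y s + h s ∈ Metric.ball (Y s) δ by simpa using hhs.trans_lt hh)
  simp only [add_sub_cancel_left] at this
  exact this.trans (by gcongr)

/-- The derivative is again a superposition operator, now for `fderiv ℝ f`, followed by a continuous
linear map. The induction therefore changes the target from `F` to `E →L[ℝ] F`; this is why `F` is
quantified inside and shares the universe of `E`. -/
theorem ContinuousMap.contDiff_nat_comp_left (n : ℕ) : ∀ {F : Type u} [NormedAddCommGroup F]
    [NormedSpace ℝ F] (f : C(E, F)), ContDiff ℝ n f →
    ContDiff ℝ n (fun Z : C(K, E) => f.comp Z) := by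
  induction n with
  | zero =>
    intro F _ _ f _
    exact contDiff_zero.2 (ContinuousMap.continuous_postcomp f)
  | succ n ih =>
    intro F _ _ f hf
    have hf1 : ContDiff ℝ n (fderiv ℝ f) := (contDiff_succ_iff_fderiv.1 (by exact_mod_cast hf)).2.2
    have hd : Differentiable ℝ f := hf.differentiable (by simp)
    let f' : C(E, E →L[ℝ] F) := ⟨fderiv ℝ f, hf1.continuous⟩
    refine contDiff_succ_iff_hasFDerivAt.2 ⟨fun Y => ContinuousMap.pointwiseApply (f'.comp Y), ?_,
      fun Y => ContinuousMap.hasFDerivAt_comp_left f f' (fun x => (hd x).hasFDerivAt) Y⟩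
    exact ContinuousMap.pointwiseApply.contDiff.comp (ih f' hf1)

theorem ContinuousMap.contDiff_infty_comp_left (f : C(E, F)) (hf : ContDiff ℝ ∞ f) :
    ContDiff ℝ ∞ (fun Z : C(K, E) => f.comp Z) :=
  contDiff_infty.2 fun n => ContinuousMap.contDiff_nat_comp_left n f (contDiff_infty.1 hf n)

end Nemytskii

/-! ### Invertibility of the identity minus a Volterra operator. -/

/-- `1 - x` is a factor of the unit `1 - x ^ n`, and it commutes with the cofactor, a geometric sum.
No bound on `‖x‖` itself is needed. -/
theorem isUnit_one_sub_of_norm_pow_lt_one {R : Type*} [NormedRing R] [HasSummableGeomSeries R]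
    {x : R} {n : ℕ} (h : ‖x ^ n‖ < 1) : IsUnit (1 - x) := by
  have h1 : IsUnit (1 - x ^ n) := isUnit_one_sub_of_norm_lt_one h
  rw [← mul_neg_geom_sum] at h1
  refine ((Commute.isUnit_mul_iff ?_).1 h1).1
  exact (Commute.one_left _).sub_left (Commute.sum_right _ _ _ fun i _ => Commute.self_pow x i)

section Volterra

open unitInterval MeasureTheory

variable {E : Type*} [NormedAddCommGroup E]

theorem continuous_IccExtend_unitInterval (h : C(I, E)) :
    Continuous (IccExtend zero_le_one h) :=
  h.continuous.Icc_extend'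

theorem norm_IccExtend_unitInterval_le (h : C(I, E)) (r : ℝ) :
    ‖IccExtend zero_le_one h r‖ ≤ ‖h‖ := h.norm_coe_le_norm _

variable [NormedSpace ℝ E]

/-- Integration from `0` on the unit interval. -/
noncomputable def unitIntegral : C(I, E) →L[ℝ] C(I, E) :=
  LinearMap.mkContinuous
    { toFun := fun h => ⟨fun t => ∫ r in (0 : ℝ)..t, IccExtend zero_le_one h r,
        (intervalIntegral.continuous_primitive
          (fun a b => (continuous_IccExtend_unitInterval h).intervalIntegrable a b) 0).comp
          continuous_subtype_val⟩
      map_add' := fun h k => by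
        ext t
        exact intervalIntegral.integral_add
          ((continuous_IccExtend_unitInterval h).intervalIntegrable _ _)
          ((continuous_IccExtend_unitInterval k).intervalIntegrable _ _)
      map_smul' := fun c h => by
        ext t
        exact intervalIntegral.integral_smul c _ } 1
    (fun h => by
      rw [one_mul]
      refine (ContinuousMap.norm_le _ (norm_nonneg _)).2 fun t => ?_
      refine (intervalIntegral.norm_integral_le_of_norm_le_const
        (C := ‖h‖) fun r _ => norm_IccExtend_unitInterval_le h r).trans ?_
      rw [sub_zero, abs_of_nonneg t.2.1]
      exact mul_le_of_le_one_right (norm_nonneg _) t.2.2)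

theorem unitIntegral_apply (h : C(I, E)) (t : I) :
    unitIntegral h t = ∫ r in (0 : ℝ)..t, IccExtend zero_le_one h r := rfl

/-- Keeping the bound pointwise in `t` is what produces the factorial: each integration turns `r ^
n` into `t ^ (n + 1) / (n + 1)`. -/
theorem norm_volterra_pow_apply_le (A : C(I, E →L[ℝ] E)) (n : ℕ) (h : C(I, E)) (t : I) :
    ‖((unitIntegral ∘L ContinuousMap.pointwiseApply A) ^ n) h t‖ ≤
      ‖A‖ ^ n * (t : ℝ) ^ n / n.factorial * ‖h‖ := by
  induction n generalizing t with
  | zero => simpa using h.norm_coe_le_norm t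
  | succ n ih =>
    rw [pow_succ', mul_apply_eq_comp]
    set k := ((unitIntegral ∘L ContinuousMap.pointwiseApply A) ^ n) h
    rw [ContinuousLinearMap.comp_apply, unitIntegral_apply]
    have hb : ∀ r ∈ Ioc (0 : ℝ) t, ‖IccExtend zero_le_one (ContinuousMap.pointwiseApply A k) r‖ ≤
        ‖A‖ * (‖A‖ ^ n * r ^ n / n.factorial * ‖h‖) := by
      intro r hr
      have hr' : r ∈ Icc (0 : ℝ) 1 := ⟨hr.1.le, hr.2.trans t.2.2⟩
      rw [IccExtend_of_mem _ _ hr']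
      refine ((A _).le_opNorm _).trans ?_
      exact mul_le_mul (A.norm_coe_le_norm _) (ih ⟨r, hr'⟩) (norm_nonneg _) (norm_nonneg A)
    refine (intervalIntegral.norm_integral_le_of_norm_le t.2.1
      (Filter.Eventually.of_forall hb) ?_).trans ?_
    · exact Continuous.intervalIntegrable (by fun_prop) _ _
    · have : ∀ r : ℝ, ‖A‖ * (‖A‖ ^ n * r ^ n / n.factorial * ‖h‖) =
          (‖A‖ ^ (n + 1) / n.factorial * ‖h‖) * r ^ n := fun r => by ring
      simp_rw [this]
      rw [intervalIntegral.integral_const_mul, integral_pow]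
      apply le_of_eq
      rw [Nat.factorial_succ]
      push_cast
      have h0 : (n.factorial : ℝ) ≠ 0 := by positivity
      field_simp
      ring

theorem isUnit_one_sub_volterra [CompleteSpace E] (A : C(I, E →L[ℝ] E)) :
    IsUnit (1 - unitIntegral ∘L ContinuousMap.pointwiseApply A) := by
  have ht := FloorSemiring.tendsto_pow_div_factorial_atTop ‖A‖
  obtain ⟨n, hn⟩ := (ht.eventually_lt_const (one_pos)).exists
  refine isUnit_one_sub_of_norm_pow_lt_one
    (x := unitIntegral ∘L ContinuousMap.pointwiseApply A) (n := n) (lt_of_le_of_lt ?_ hn)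
  refine ContinuousLinearMap.opNorm_le_bound _ (by positivity) fun h => ?_
  refine (ContinuousMap.norm_le _ (by positivity)).2 fun t => ?_
  refine (norm_volterra_pow_apply_le A n h t).trans ?_
  gcongr
  exact mul_le_of_le_one_right (by positivity) (pow_le_one₀ t.2.1 t.2.2)

end Volterra

/-! ### Smooth dependence of solutions on initial value and time. -/

section Flow

open unitInterval

universe u

variable {E : Type u} [NormedAddCommGroup E] [NormedSpace ℝ E]

/-- Two solutions of an autonomous equation with a `C¹` right-hand side and the same initial value
agree. -/
theorem eqOn_of_hasDerivWithinAt_autonomous [FiniteDimensional ℝ E] {v : E → E}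
    (hv : ContDiff ℝ 1 v) {a b : ℝ} {α β : ℝ → E}
    (hα : ∀ t ∈ Icc a b, HasDerivWithinAt α (v (α t)) (Icc a b) t)
    (hβ : ∀ t ∈ Icc a b, HasDerivWithinAt β (v (β t)) (Icc a b) t)
    (h0 : α a = β a) : EqOn α β (Icc a b) := by
  have hαc : ContinuousOn α (Icc a b) := HasDerivWithinAt.continuousOn hα
  have hβc : ContinuousOn β (Icc a b) := HasDerivWithinAt.continuousOn hβ
  obtain ⟨r, hr⟩ := (((isCompact_Icc.image_of_continuousOn hαc).union
    (isCompact_Icc.image_of_continuousOn hβc)).isBounded).subset_closedBall (0 : E)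
  have := FiniteDimensional.proper ℝ E
  obtain ⟨L, hL⟩ := (hv.contDiffOn (s := Metric.closedBall (0 : E) r)).exists_lipschitzOnWith
    one_ne_zero (convex_closedBall _ _) (isCompact_closedBall _ _)
  have right : ∀ {γ : ℝ → E}, (∀ t ∈ Icc a b, HasDerivWithinAt γ (v (γ t)) (Icc a b) t) →
      ∀ t ∈ Ico a b, HasDerivWithinAt γ (v (γ t)) (Ici t) t := fun h t ht =>
    (h t (Ico_subset_Icc_self ht)).mono_of_mem_nhdsWithin (Icc_mem_nhdsGE_of_mem ht)
  exact ODE_solution_unique_of_mem_Icc_right (v := fun _ => v)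
    (s := fun _ => Metric.closedBall (0 : E) r) (fun _ _ => hL) hαc (right hα)
    (fun t ht => hr (Or.inl (mem_image_of_mem _ (Ico_subset_Icc_self ht)))) hβc (right hβ)
    (fun t ht => hr (Or.inr (mem_image_of_mem _ (Ico_subset_Icc_self ht)))) h0

/-- Constant functions on the unit interval, as a continuous linear map. -/
noncomputable def unitConst : E →L[ℝ] C(I, E) :=
  LinearMap.mkContinuous
    { toFun := ContinuousMap.const I
      map_add' := fun _ _ => rfl
      map_smul' := fun _ _ => rfl } 1
    (fun x => by
      rw [one_mul]
      exact (ContinuousMap.norm_le _ (norm_nonneg x)).2 fun _ => le_rfl)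

/-- The residual of the integral equation `Y t = y + s ∫₀ᵗ f (Y r) dr` on the unit interval. -/
noncomputable def picardResidual (f : C(E, E)) (p : (E × ℝ) × C(I, E)) : C(I, E) :=
  p.2 - unitConst p.1.1 - p.1.2 • unitIntegral (f.comp p.2)

theorem contDiff_picardResidual (f : C(E, E)) (hf : ContDiff ℝ ∞ f) :
    ContDiff ℝ ∞ (picardResidual f) := by
  have h1 : ContDiff ℝ ∞ fun p : (E × ℝ) × C(I, E) => f.comp p.2 :=
    (ContinuousMap.contDiff_infty_comp_left f hf).comp contDiff_snd
  have h2 : ContDiff ℝ ∞ fun p : (E × ℝ) × C(I, E) => unitIntegral (f.comp p.2) :=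
    h1.continuousLinearMap_comp unitIntegral
  have h0 : ContDiff ℝ ∞ fun p : (E × ℝ) × C(I, E) => p.1.1 := contDiff_fst.comp contDiff_fst
  have h3 : ContDiff ℝ ∞ fun p : (E × ℝ) × C(I, E) => unitConst p.1.1 :=
    h0.continuousLinearMap_comp unitConst
  have h4 : ContDiff ℝ ∞ fun p : (E × ℝ) × C(I, E) => p.1.2 := contDiff_snd.comp contDiff_fst
  exact (contDiff_snd.sub h3).sub (h4.smul h2)

/-- The partial derivative in `Y` is the identity minus the Volterra operator with coefficient `s •
f'(Y)`. -/
theorem isInvertible_fderiv_picardResidual [CompleteSpace E] (f : C(E, E)) (hf : ContDiff ℝ ∞ f)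
    (p : (E × ℝ) × C(I, E)) :
    (fderiv ℝ (picardResidual f) p ∘L ContinuousLinearMap.inr ℝ (E × ℝ) C(I, E)).IsInvertible := by
  let f' : C(E, E →L[ℝ] E) := ⟨fderiv ℝ f, hf.continuous_fderiv (by simp)⟩
  have hd : Differentiable ℝ f := hf.differentiable (by simp)
  have h1 : HasFDerivAt (fun Z => picardResidual f (p.1, Z))
      (fderiv ℝ (picardResidual f) p ∘L ContinuousLinearMap.inr ℝ (E × ℝ) C(I, E)) p.2 :=
    HasFDerivAt.comp (g := picardResidual f) (f := fun Z => (p.1, Z)) p.2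
      ((contDiff_picardResidual f hf).differentiable (by simp) p).hasFDerivAt
      (hasFDerivAt_prodMk_right p.1 p.2)
  have h2 : HasFDerivAt (fun Z => picardResidual f (p.1, Z))
      (1 - unitIntegral ∘L ContinuousMap.pointwiseApply (p.1.2 • f'.comp p.2)) p.2 := by
    have h3 := ((hasFDerivAt_id p.2).sub_const (unitConst p.1.1)).sub
      ((unitIntegral.hasFDerivAt.comp p.2
        (ContinuousMap.hasFDerivAt_comp_left f f' (fun x => (hd x).hasFDerivAt) p.2)).const_smul
          p.1.2)
    refine h3.congr_fderiv ?_
    ext h t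
    simp
  rw [h1.unique h2]
  obtain ⟨w, hw⟩ := isUnit_one_sub_volterra (p.1.2 • f'.comp p.2)
  exact ⟨ContinuousLinearEquiv.ofUnit w, hw⟩

theorem picardResidual_eq_zero_iff [CompleteSpace E] (f : C(E, E)) (y : E) (s : ℝ) (Y : C(I, E)) :
    picardResidual f ((y, s), Y) = 0 ↔ IccExtend zero_le_one Y 0 = y ∧
      ∀ t ∈ Icc (0 : ℝ) 1, HasDerivWithinAt (IccExtend zero_le_one Y)
        (s • f (IccExtend zero_le_one Y t)) (Icc 0 1) t := by
  have hfc : Continuous (Function.uncurry fun (_ : ℝ) (x : E) => s • f x) :=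
    (f.continuous.comp continuous_snd).const_smul s
  have hval : ∀ t : I, picardResidual f ((y, s), Y) t =
      IccExtend zero_le_one Y t -
        ODE.picard (fun _ x => s • f x) 0 y (IccExtend zero_le_one Y) t := by
    intro t
    rw [ODE.picard_apply, intervalIntegral.integral_smul, IccExtend_val, ← sub_sub]
    rfl
  constructor
  · intro h
    have heq : ∀ t ∈ Icc (0 : ℝ) 1, IccExtend zero_le_one Y t =
        ODE.picard (fun _ x => s • f x) 0 y (IccExtend zero_le_one Y) t := fun t ht => by
      rw [← sub_eq_zero, ← hval ⟨t, ht⟩, h]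
      rfl
    refine ⟨by rw [heq 0 (by simp), ODE.picard_apply₀], fun t ht => ?_⟩
    exact (ODE.hasDerivWithinAt_picard_Icc (u := univ) (f := fun _ x => s • f x)
      (by simp) hfc.continuousOn (continuous_IccExtend_unitInterval Y).continuousOn
      (fun _ _ => trivial) y ht).congr_of_mem heq ht
  · rintro ⟨h0, h⟩
    ext t
    rw [hval, ContinuousMap.zero_apply, sub_eq_zero, ← h0]
    have hsub : uIcc (0 : ℝ) t ⊆ Icc 0 1 := uIcc_subset_Icc (by simp) t.2
    exact (ODE.picard_eq_of_hasDerivAt (u := univ) (f := fun _ x => s • f x) hfc.continuousOn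
      (fun t' ht' => (h t' (hsub ht')).mono hsub) (fun _ _ => trivial)).symm

theorem picardResidual_unique [FiniteDimensional ℝ E] (f : C(E, E)) (hf : ContDiff ℝ ∞ f)
    (p : E × ℝ) {Y Z : C(I, E)} (hY : picardResidual f (p, Y) = 0)
    (hZ : picardResidual f (p, Z) = 0) : Y = Z := by
  have := FiniteDimensional.complete ℝ E
  obtain ⟨hY0, hY⟩ := (picardResidual_eq_zero_iff f p.1 p.2 Y).1 hY
  obtain ⟨hZ0, hZ⟩ := (picardResidual_eq_zero_iff f p.1 p.2 Z).1 hZ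
  have := eqOn_of_hasDerivWithinAt_autonomous (v := fun x => p.2 • f x)
    ((contDiff_const.smul hf).of_le (by simp)) hY hZ (hY0.trans hZ0.symm)
  ext t
  simpa using this t.2

/-- Rescaling time turns a solution on `[0, T]` into one on the unit interval. -/
theorem picardResidual_rescale [CompleteSpace E] (f : C(E, E)) {α : ℝ → E} {T s : ℝ}
    (hs : s ∈ Icc 0 T) (hα : ∀ t ∈ Icc 0 T, HasDerivWithinAt α (f (α t)) (Icc 0 T) t) :
    ∃ Y : C(I, E), picardResidual f ((α 0, s), Y) = 0 ∧ Y 1 = α s := by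
  have hmaps : MapsTo (fun t : ℝ => s * t) (Icc 0 1) (Icc 0 T) := fun t ht =>
    ⟨mul_nonneg hs.1 ht.1, (mul_le_of_le_one_right hs.1 ht.2).trans hs.2⟩
  have hd : ∀ t ∈ Icc (0 : ℝ) 1,
      HasDerivWithinAt (fun t => α (s * t)) (s • f (α (s * t))) (Icc 0 1) t := by
    intro t ht
    have h1 : HasDerivWithinAt (fun t : ℝ => s * t) s (Icc 0 1) t := by
      simpa using ((hasDerivAt_id t).const_mul s).hasDerivWithinAt
    exact HasDerivWithinAt.scomp t (hα _ (hmaps ht)) h1 hmaps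
  have hc : ContinuousOn (fun t => α (s * t)) (Icc 0 1) := HasDerivWithinAt.continuousOn hd
  let Y : C(I, E) := ⟨fun t => α (s * t), continuousOn_iff_continuous_domRestrict.1 hc⟩
  have hY : ∀ t ∈ Icc (0 : ℝ) 1, IccExtend zero_le_one Y t = α (s * t) := fun t ht =>
    IccExtend_of_mem _ _ ht
  refine ⟨Y, (picardResidual_eq_zero_iff f _ _ Y).2 ⟨?_, fun t ht => ?_⟩, ?_⟩
  · rw [hY 0 (by simp), mul_zero]
  · rw [hY t ht]
    exact (hd t ht).congr_of_mem hY ht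
  · change α (s * 1) = α s
    rw [mul_one]

/-- Smooth dependence on the initial value and on time: if the solution with initial value `α 0`
exists on `[0, T]`, then so do the solutions with nearby initial values, and they depend smoothly
on the initial value and time together. -/
theorem exists_contDiffOn_flow [FiniteDimensional ℝ E] {f : E → E} (hf : ContDiff ℝ ∞ f)
    {T : ℝ} (hT : 0 < T) {α : ℝ → E}
    (hα : ∀ t ∈ Icc 0 T, HasDerivWithinAt α (f (α t)) (Icc 0 T) t) :
    ∃ (V : Set E) (G : E × ℝ → E), IsOpen V ∧ α 0 ∈ V ∧ ContDiffOn ℝ ∞ G (V ×ˢ Icc 0 T) ∧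
      ∀ y ∈ V, G (y, 0) = y ∧
        ∀ t ∈ Icc 0 T, HasDerivWithinAt (fun t => G (y, t)) (f (G (y, t))) (Icc 0 T) t := by
  have := FiniteDimensional.complete ℝ E
  let fc : C(E, E) := ⟨f, hf.continuous⟩
  -- `sol (y, s)` is the trajectory from `y` up to time `s`, reparametrised to `[0, 1]`, so its
  -- value at `1` is the flow at time `s`.
  let D : Set (E × ℝ) := {p | ∃ Y, picardResidual fc (p, Y) = 0}
  let sol : E × ℝ → C(I, E) := fun p => Classical.epsilon fun Y => picardResidual fc (p, Y) = 0
  have hsol : ∀ {p Y}, picardResidual fc (p, Y) = 0 → sol p = Y := fun {p Y} h =>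
    picardResidual_unique fc hf p 
      (Classical.epsilon_spec (p := fun Y => picardResidual fc (p, Y) = 0) ⟨Y, h⟩) h
  have local_sol : ∀ p ∈ D, (∀ᶠ q in 𝓝 p, q ∈ D) ∧ ContDiffAt ℝ ∞ (fun q => sol q 1) p := by
    rintro p ⟨Y, hY⟩
    have hc : ContDiffAt ℝ ∞ (picardResidual fc) (p, Y) :=
      (contDiff_picardResidual fc hf).contDiffAt
    have hinv := isInvertible_fderiv_picardResidual fc hf (p, Y)
    have hev := hc.eventually_apply_implicitFunction (by simp) hinv
    simp only [hY] at hev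
    refine ⟨hev.mono fun q hq => ⟨_, hq⟩, ?_⟩
    have hsm := (ContinuousMap.evalCLM ℝ (1 : I)).contDiff.contDiffAt.comp p
      (hc.contDiffAt_implicitFunction (by simp) hinv)
    -- By uniqueness the chosen solution agrees with the implicit function near `p`.
    refine hsm.congr_of_eventuallyEq (hev.mono fun q hq => ?_)
    simp only [hsol hq]
    rfl
  have hD : IsOpen D := isOpen_iff_mem_nhds.2 fun p hp => (local_sol p hp).1
  have hsub : {α 0} ×ˢ Icc 0 T ⊆ D := by
    rintro ⟨y, s⟩ ⟨hy, hs⟩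
    obtain rfl : y = α 0 := hy
    obtain ⟨Y, hY, -⟩ := picardResidual_rescale fc hs hα
    exact ⟨Y, hY⟩
  -- Compactness of `[0, T]` yields one neighbourhood of initial values that works for all times.
  obtain ⟨V, W, hV, -, hαV, hTW, hVW⟩ :=
    generalized_tube_lemma isCompact_singleton isCompact_Icc hD hsub
  refine ⟨V, fun p => sol p 1, hV, hαV rfl, fun p hp =>
    (local_sol p (hVW ⟨hp.1, hTW hp.2⟩)).2.contDiffWithinAt, fun y hy => ?_⟩
  obtain ⟨Y, hY⟩ : (y, T) ∈ D := hVW ⟨hy, hTW ⟨hT.le, le_rfl⟩⟩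
  obtain ⟨hY0, hYd⟩ := (picardResidual_eq_zero_iff fc y T Y).1 hY
  have hmaps : MapsTo (fun t : ℝ => T⁻¹ * t) (Icc 0 T) (Icc 0 1) := fun t ht =>
    ⟨mul_nonneg (inv_nonneg.2 hT.le) ht.1, by
      rw [inv_mul_le_iff₀ hT, mul_one]; exact ht.2⟩
  have hβ : ∀ t ∈ Icc 0 T, HasDerivWithinAt (fun t => IccExtend zero_le_one Y (T⁻¹ * t))
      (f (IccExtend zero_le_one Y (T⁻¹ * t))) (Icc 0 T) t := by
    intro t ht
    have h1 : HasDerivWithinAt (fun t : ℝ => T⁻¹ * t) T⁻¹ (Icc 0 T) t := by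
      simpa using ((hasDerivAt_id t).const_mul T⁻¹).hasDerivWithinAt
    have h2 := HasDerivWithinAt.scomp t (hYd _ (hmaps ht)) h1 hmaps
    rw [smul_smul, inv_mul_cancel₀ hT.ne', one_smul] at h2
    exact h2
  -- The separate problems for the times `t` all trace the single trajectory obtained at time `T`.
  have hG : ∀ t ∈ Icc 0 T, sol (y, t) 1 = IccExtend zero_le_one Y (T⁻¹ * t) := by
    intro t ht
    obtain ⟨Z, hZ, hZ1⟩ := picardResidual_rescale fc ht hβ
    simp only [mul_zero, hY0] at hZ
    rw [hsol hZ, hZ1]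
  refine ⟨?_, fun t ht => ?_⟩
  · simp only [hG 0 ⟨le_rfl, hT.le⟩, mul_zero, hY0]
  · simp only [hG t ht]
    exact (hβ t ht).congr_of_mem hG ht

end Flow

/-! ### Local smooth left inverses of embeddings. -/

/-- A topological embedding has a smooth left inverse near each point where it is an immersion. -/
theorem exists_contDiffOn_leftInverse {X Y : Type*} [NormedAddCommGroup X] [NormedSpace ℝ X]
    [FiniteDimensional ℝ X] [NormedAddCommGroup Y] [NormedSpace ℝ Y] [FiniteDimensional ℝ Y]
    {f : X → Y} (hf : ContDiff ℝ ∞ f) (hemb : IsEmbedding f) (x₀ : X)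
    (himm : Function.Injective (fderiv ℝ f x₀)) :
    ∃ (N : Set Y) (ρ : Y → X), IsOpen N ∧ f x₀ ∈ N ∧ ContDiffOn ℝ ∞ ρ N ∧
      ∀ x, f x ∈ N → ρ (f x) = x := by
  have := FiniteDimensional.complete ℝ X
  obtain ⟨L₀, hL₀⟩ := (fderiv ℝ f x₀).toLinearMap.exists_leftInverse_of_injective
    (LinearMap.ker_eq_bot.2 himm)
  let L : Y →L[ℝ] X := L₀.toContinuousLinearMap
  let h : X → X := fun x => L (f x)
  have hh : ContDiff ℝ ∞ h := hf.continuousLinearMap_comp L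
  have hh' : HasFDerivAt h ((ContinuousLinearEquiv.refl ℝ X : X ≃L[ℝ] X) : X →L[ℝ] X) x₀ := by
    have h1 : HasFDerivAt h (L ∘L fderiv ℝ f x₀) x₀ :=
      L.hasFDerivAt.comp x₀ (hf.differentiable (by simp) x₀).hasFDerivAt
    refine h1.congr_fderiv ?_
    ext v
    exact LinearMap.congr_fun hL₀ v
  let e := hh.contDiffAt.toOpenPartialHomeomorph h hh' (by simp)
  have hx₀ : x₀ ∈ e.source := hh.contDiffAt.mem_toOpenPartialHomeomorph_source hh' (by simp)
  have he : ∀ x, e x = h x := fun _ => rfl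
  -- The embedding property makes every `x` with `f x ∈ M` lie in the domain where `h = L ∘ f` is
  -- inverted; otherwise points far from `x₀` could map near `f x₀`.
  obtain ⟨M, hM, hMe⟩ := hemb.isInducing.isOpen_iff.1 e.open_source
  -- Restricting to invertible derivatives of `h` makes the inverse smooth on a whole open set, not
  -- only at `h x₀`.
  let R : Set X := {x | fderiv ℝ h x ∈ range ((↑) : (X ≃L[ℝ] X) → X →L[ℝ] X)}
  have hR : IsOpen R :=
    (ContinuousLinearEquiv.isOpen (𝕜 := ℝ) (E := X) (F := X)).preimage
      (hh.continuous_fderiv (by simp))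
  have hR₀ : x₀ ∈ R := ⟨_, hh'.fderiv.symm⟩
  let T : Set X := e.target ∩ e.symm ⁻¹' R
  have hT : IsOpen T := e.symm.isOpen_inter_preimage hR
  refine ⟨M ∩ L ⁻¹' T, fun y => e.symm (L y), hM.inter (hT.preimage L.continuous), ⟨?_, ?_, ?_⟩,
    ?_, ?_⟩
  · change x₀ ∈ f ⁻¹' M
    rwa [hMe]
  · exact e.map_source hx₀
  · change e.symm (e x₀) ∈ R
    rwa [e.left_inv hx₀]
  · rintro y ⟨-, hyt, w, hw⟩
    have h1 : ContDiffAt ℝ ∞ e.symm (L y) :=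
      e.contDiffAt_symm hyt (f₀' := w)
        (by rw [hw]; exact (hh.differentiable (by simp) _).hasFDerivAt) hh.contDiffAt
    exact (h1.comp y L.contDiff.contDiffAt).contDiffWithinAt
  · rintro x ⟨hxM, -⟩
    exact e.left_inv (hMe ▸ hxM : x ∈ e.source)

/-! ### Smooth families and the topology of the configuration space. -/

namespace ConfigSpace

variable {l : ℝ} {hl : 0 < l}

theorem curve_of_mem (q : ConfigSpace l hl) {s : ℝ} (hs : s ∈ Icc 0 l) :
    q.curve s = q.1 ⟨s, hs⟩ := IccExtend_of_mem _ _ hs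

theorem ext_curve {q r : ConfigSpace l hl} (h : EqOn q.curve r.curve (Icc 0 l)) : q = r := by
  apply Subtype.ext
  funext s
  rw [← curve_of_mem q s.2, ← curve_of_mem r s.2, h s.2]

theorem continuous_curve_apply {s : ℝ} (hs : s ∈ Icc 0 l) :
    Continuous fun q : ConfigSpace l hl => q.curve s := by
  have h1 : Continuous fun q : ConfigSpace l hl => UniformFun.ofFun
      (fun s : Icc (0 : ℝ) l => iteratedDerivWithin 0 q.curve (Icc 0 l) (s : ℝ)) :=
    continuous_iInf_dom (i := 0) continuous_induced_dom
  have h2 := (UniformFun.uniformContinuous_eval (Mat4 × Vec6)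
    (⟨s, hs⟩ : Icc (0 : ℝ) l)).continuous.comp h1
  refine h2.congr fun q => ?_
  exact congrFun (iteratedDerivWithin_zero (f := q.curve) (s := Icc 0 l) (𝕜 := ℝ)) s

/-- The derivatives in time of a smooth family are smooth in the parameter and time together. -/
theorem SmoothFamilyOn.contDiffOn_iteratedDerivWithin {X : Type*} [NormedAddCommGroup X]
    [NormedSpace ℝ X] {V : Set X} {P : X → ConfigSpace l hl} (hV : IsOpen V)
    (hP : SmoothFamilyOn V P) (k : ℕ) :
    ContDiffOn ℝ ∞ (fun p : X × ℝ => iteratedDerivWithin k (P p.1).curve (Icc 0 l) p.2)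
      (V ×ˢ Icc 0 l) := by
  have hI : UniqueDiffOn ℝ (Icc 0 l) := uniqueDiffOn_Icc hl
  have hU : UniqueDiffOn ℝ (V ×ˢ Icc 0 l) := hV.uniqueDiffOn.prod hI
  induction k with
  | zero =>
    simp only [iteratedDerivWithin_zero]
    exact hP
  | succ k ih =>
    have h1 := (ih.fderivWithin hU (m := ∞) (by simp)).clm_apply
      (contDiffOn_const (c := ((0 : X), (1 : ℝ))))
    refine h1.congr ?_
    rintro ⟨x, s⟩ ⟨hx, hs⟩
    rw [iteratedDerivWithin_succ]
    have h2 := (ih.differentiableOn (by simp) (x, s) ⟨hx, hs⟩).hasFDerivWithinAt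
    have h3 : HasDerivWithinAt (fun r : ℝ => (x, r)) ((0 : X), (1 : ℝ)) (Icc 0 l) s :=
      (hasDerivWithinAt_const s _ x).prodMk (hasDerivWithinAt_id s _)
    have h4 := h2.comp_hasDerivWithinAt s h3 fun r hr => ⟨hx, hr⟩
    exact h4.derivWithin (hI s hs)

theorem SmoothFamilyOn.continuousAt {X : Type*} [NormedAddCommGroup X] [NormedSpace ℝ X]
    [LocallyCompactSpace X] {V : Set X} {P : X → ConfigSpace l hl} (hV : IsOpen V)
    (hP : SmoothFamilyOn V P) {x : X} (hx : x ∈ V) : ContinuousAt P x := by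
  unfold ContinuousAt
  rw [nhds_iInf, Filter.tendsto_iInf]
  intro k
  rw [nhds_induced, Filter.tendsto_comap_iff, UniformFun.tendsto_iff_tendstoUniformly]
  -- Joint continuity of each time derivative becomes uniform convergence because `[0, l]` is
  -- compact.
  refine ContinuousOn.tendstoUniformly
    (f := fun x (s : Icc (0 : ℝ) l) => iteratedDerivWithin k (P x).curve (Icc 0 l) (s : ℝ))
    (hV.mem_nhds hx) ?_
  exact (hP.contDiffOn_iteratedDerivWithin hV k).continuousOn.comp
    (f := fun p : X × Icc (0 : ℝ) l => (p.1, (p.2 : ℝ)))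
    (continuous_fst.prodMk (continuous_subtype_val.comp continuous_snd)).continuousOn
    fun p hp => ⟨hp.1, p.2.2⟩

theorem SmoothFamilyOn.contDiffOn_curve_apply {X : Type*} [NormedAddCommGroup X]
    [NormedSpace ℝ X] {V : Set X} {P : X → ConfigSpace l hl} (hP : SmoothFamilyOn V P) {s : ℝ}
    (hs : s ∈ Icc 0 l) : ContDiffOn ℝ ∞ (fun x => (P x).curve s) V :=
  hP.comp (f := fun x : X => (x, s)) (contDiff_id.prodMk contDiff_const).contDiffOn
    fun _ hx => ⟨hx, hs⟩

end ConfigSpace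

/-! ### Calculus of matrix-valued maps. -/

section MatrixCalculus

variable {X : Type*} [NormedAddCommGroup X] [NormedSpace ℝ X] {k : WithTop ℕ∞}
  {ι κ μ : Type*} [Fintype κ]

theorem contDiff_matrix_iff [Fintype ι] {f : X → Matrix ι κ ℝ} :
    ContDiff ℝ k f ↔ ∀ i j, ContDiff ℝ k fun x => f x i j :=
  (contDiff_pi (𝕜 := ℝ) (F' := fun _ : ι => κ → ℝ)).trans (forall_congr' fun _ => contDiff_pi)

theorem hasDerivWithinAt_matrix_iff {f : ℝ → Matrix ι κ ℝ} {f' : Matrix ι κ ℝ} {S : Set ℝ}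
    {s : ℝ} :
    HasDerivWithinAt f f' S s ↔ ∀ i j, HasDerivWithinAt (fun x => f x i j) (f' i j) S s :=
  (hasDerivWithinAt_pi (𝕜 := ℝ) (E' := fun _ : ι => κ → ℝ)).trans
    (forall_congr' fun _ => hasDerivWithinAt_pi)

theorem ContDiff.matrix_mul [Fintype ι] [Fintype μ] {f : X → Matrix ι κ ℝ} {g : X → Matrix κ μ ℝ}
    (hf : ContDiff ℝ k f) (hg : ContDiff ℝ k g) : ContDiff ℝ k fun x => f x * g x := by
  rw [contDiff_matrix_iff] at *
  intro i j
  simp only [Matrix.mul_apply]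
  exact ContDiff.sum fun m _ => (hf i m).mul (hg m j)

theorem ContDiff.matrix_mulVec [Fintype ι] {f : X → Matrix ι κ ℝ} {g : X → κ → ℝ}
    (hf : ContDiff ℝ k f) (hg : ContDiff ℝ k g) : ContDiff ℝ k fun x => f x *ᵥ g x := by
  rw [contDiff_matrix_iff] at hf
  rw [contDiff_pi] at *
  intro i
  simp only [Matrix.mulVec, dotProduct]
  exact ContDiff.sum fun m _ => (hf i m).mul (hg m)

theorem ContDiff.matrix_transpose [Fintype ι] {f : X → Matrix ι κ ℝ} (hf : ContDiff ℝ k f) :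
    ContDiff ℝ k fun x => (f x)ᵀ :=
  contDiff_matrix_iff.2 fun i j => contDiff_matrix_iff.1 hf j i

theorem HasDerivWithinAt.matrix_mul [Fintype μ] {f : ℝ → Matrix ι κ ℝ} {f' : Matrix ι κ ℝ}
    {g : ℝ → Matrix κ μ ℝ} {g' : Matrix κ μ ℝ} {S : Set ℝ} {s : ℝ}
    (hf : HasDerivWithinAt f f' S s) (hg : HasDerivWithinAt g g' S s) :
    HasDerivWithinAt (fun x => f x * g x) (f' * g s + f s * g') S s := by
  rw [hasDerivWithinAt_matrix_iff] at *
  intro i j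
  simp only [Matrix.mul_apply, Matrix.add_apply, ← Finset.sum_add_distrib]
  exact HasDerivWithinAt.fun_sum fun m _ => (hf i m).mul (hg m j)

theorem HasDerivWithinAt.matrix_mulVec (C : Matrix ι κ ℝ) {f : ℝ → κ → ℝ} {f' : κ → ℝ}
    {S : Set ℝ} {s : ℝ} (hf : HasDerivWithinAt f f' S s) :
    HasDerivWithinAt (fun x => C *ᵥ f x) (C *ᵥ f') S s := by
  rw [hasDerivWithinAt_pi] at *
  intro i
  simp only [Matrix.mulVec, dotProduct]
  exact HasDerivWithinAt.fun_sum fun m _ => (hf m).const_mul (C i m)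

theorem HasDerivWithinAt.matrix_transpose [Fintype ι] {f : ℝ → Matrix ι κ ℝ} {f' : Matrix ι κ ℝ}
    {S : Set ℝ} {s : ℝ} (hf : HasDerivWithinAt f f' S s) :
    HasDerivWithinAt (fun x => (f x)ᵀ) f'ᵀ S s :=
  hasDerivWithinAt_matrix_iff.2 fun i j => hasDerivWithinAt_matrix_iff.1 hf j i

end MatrixCalculus

/-- A function whose derivative vanishes on an interval is constant there. -/
theorem eq_of_hasDerivWithinAt_Icc_zero {E : Type*} [NormedAddCommGroup E] [NormedSpace ℝ E]
    {f : ℝ → E} {a b : ℝ} (hf : ∀ s ∈ Icc a b, HasDerivWithinAt f 0 (Icc a b) s) {s : ℝ}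
    (hs : s ∈ Icc a b) : f s = f a :=
  constant_of_has_deriv_right_zero (HasDerivWithinAt.continuousOn hf)
    (fun t ht => (hf t (Ico_subset_Icc_self ht)).mono_of_mem_nhdsWithin
      (Icc_mem_nhdsGE_of_mem ht)) s hs

theorem contDiff_hat3 : ContDiff ℝ ∞ hat3 := by
  refine contDiff_matrix_iff.2 fun i j => ?_
  fin_cases i <;> fin_cases j <;> simp [hat3] <;> fun_prop

theorem contDiff_hat6 : ContDiff ℝ ∞ hat6 := by
  have h1 : ContDiff ℝ ∞ fun ξ : Vec6 => hat3 fun i => ξ (Sum.inl i) :=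
    contDiff_hat3.comp (by fun_prop)
  refine contDiff_matrix_iff.2 fun i j => ?_
  rcases i with i | i <;> rcases j with j | j <;> simp only [hat6, Matrix.fromBlocks_apply₁₁,
    Matrix.fromBlocks_apply₁₂, Matrix.fromBlocks_apply₂₁, Matrix.fromBlocks_apply₂₂,
    Matrix.replicateCol_apply, Matrix.zero_apply]
  · exact contDiff_matrix_iff.1 h1 i j
  all_goals fun_prop

theorem contDiff_adMatrix : ContDiff ℝ ∞ adMatrix := by
  have h1 : ContDiff ℝ ∞ fun ξ : Vec6 => hat3 fun i => ξ (Sum.inl i) :=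
    contDiff_hat3.comp (by fun_prop)
  have h2 : ContDiff ℝ ∞ fun ξ : Vec6 => hat3 fun i => ξ (Sum.inr i) :=
    contDiff_hat3.comp (by fun_prop)
  refine contDiff_matrix_iff.2 fun i j => ?_
  rcases i with i | i <;> rcases j with j | j <;> simp only [adMatrix, Matrix.fromBlocks_apply₁₁,
    Matrix.fromBlocks_apply₁₂, Matrix.fromBlocks_apply₂₁, Matrix.fromBlocks_apply₂₂,
    Matrix.zero_apply]
  · exact contDiff_matrix_iff.1 h1 i j
  · exact contDiff_const
  · exact contDiff_matrix_iff.1 h2 i j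
  · exact contDiff_matrix_iff.1 h1 i j

theorem contDiff_potentialWrench {U : Mat4 → ℝ} (hU : ContDiff ℝ ∞ U) :
    ContDiff ℝ ∞ (potentialWrench U) := by
  refine contDiff_pi.2 fun i => ContDiff.neg ?_
  exact (hU.fderiv_right (m := ∞) (by simp)).clm_apply (contDiff_id.matrix_mul contDiff_const)

theorem hat3_transpose (w : Fin 3 → ℝ) : (hat3 w)ᵀ = -hat3 w := by
  ext i j
  fin_cases i <;> fin_cases j <;> simp [hat3]

/-! ### Invariance of `SE(3)`. -/

/-- A curve of matrices that starts at the identity and moves along body twists stays in `SE(3)`. -/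
theorem mem_SE3_of_hasDerivWithinAt {l : ℝ} {g : ℝ → Mat4} {ξ : ℝ → Vec6}
    (h0 : g 0 = 1)
    (hg : ∀ s ∈ Icc 0 l, HasDerivWithinAt g (g s * hat6 (ξ s)) (Icc 0 l) s) {s : ℝ}
    (hs : s ∈ Icc 0 l) : g s ∈ SE3 := by
  -- `g D gᵀ` is conserved because `hat3` is skew. Its value `D` forces the rotation block to be
  -- orthogonal and the lower left block to vanish.
  let D : Mat4 := Matrix.fromBlocks 1 0 0 0
  have hDskew : ∀ ζ : Vec6, hat6 ζ * D + D * (hat6 ζ)ᵀ = 0 := by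
    intro ζ
    simp [D, hat6, Matrix.fromBlocks_multiply, Matrix.fromBlocks_transpose, Matrix.fromBlocks_add,
      hat3_transpose]
  have hconst : ∀ s ∈ Icc 0 l, g s * D * (g s)ᵀ = D := by
    intro s hs
    have hd : ∀ t ∈ Icc 0 l,
        HasDerivWithinAt (fun t => g t * D * (g t)ᵀ) 0 (Icc 0 l) t := by
      intro t ht
      have h1 := ((hg t ht).matrix_mul (hasDerivWithinAt_const t (Icc 0 l) D)).matrix_mul
        (hg t ht).matrix_transpose
      refine h1.congr_deriv ?_
      rw [mul_zero, add_zero, Matrix.transpose_mul]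
      have : g t * hat6 (ξ t) * D * (g t)ᵀ + g t * D * ((hat6 (ξ t))ᵀ * (g t)ᵀ) =
          g t * (hat6 (ξ t) * D + D * (hat6 (ξ t))ᵀ) * (g t)ᵀ := by
        simp only [Matrix.mul_add, Matrix.add_mul, Matrix.mul_assoc]
      rw [this, hDskew]
      simp
    rw [eq_of_hasDerivWithinAt_Icc_zero hd hs, h0]
    simp
  have hblocks : ∀ s ∈ Icc 0 l, (g s).toBlocks₁₁ * (g s).toBlocks₁₁ᵀ = 1 ∧
      (g s).toBlocks₂₁ = 0 := by
    intro s hs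
    have h1 := hconst s hs
    rw [← Matrix.fromBlocks_toBlocks (g s)] at h1
    simp only [D, Matrix.fromBlocks_multiply, Matrix.fromBlocks_transpose, mul_one, mul_zero,
      zero_mul, add_zero, Matrix.mul_one, Matrix.mul_zero, Matrix.zero_mul,
      Matrix.fromBlocks_inj] at h1
    obtain ⟨h11, -, h21, -⟩ := h1
    refine ⟨h11, ?_⟩
    have h2 : (g s).toBlocks₁₁ᵀ * (g s).toBlocks₁₁ = 1 := mul_eq_one_comm.1 h11
    calc (g s).toBlocks₂₁ = (g s).toBlocks₂₁ * ((g s).toBlocks₁₁ᵀ * (g s).toBlocks₁₁) := by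
          rw [h2, Matrix.mul_one]
      _ = 0 := by rw [← Matrix.mul_assoc, h21, Matrix.zero_mul]
  have hcorner : (g s).toBlocks₂₂ = 1 := by
    have hd : ∀ t ∈ Icc 0 l,
        HasDerivWithinAt (fun t => g t (Sum.inr ()) (Sum.inr ())) 0 (Icc 0 l) t := by
      intro t ht
      refine (hasDerivWithinAt_matrix_iff.1 (hg t ht) (Sum.inr ()) (Sum.inr ())).congr_deriv ?_
      have h2 : ∀ j, g t (Sum.inr ()) (Sum.inl j) = 0 := fun j =>
        congrFun (congrFun (hblocks t ht).2 ()) j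
      simp [Matrix.mul_apply, h2, hat6]
    ext i j
    have := eq_of_hasDerivWithinAt_Icc_zero hd hs
    simpa [h0, Matrix.toBlocks₂₂] using this
  have hdet : (g s).toBlocks₁₁.det = 1 := by
    have hc : ContinuousOn (fun t => (g t).toBlocks₁₁.det) (Icc 0 l) := by
      have hgc : ContinuousOn g (Icc 0 l) := HasDerivWithinAt.continuousOn hg
      refine (Continuous.matrix_det continuous_id).comp_continuousOn ?_
      refine Continuous.comp_continuousOn (g := fun M : Mat4 => M.toBlocks₁₁) ?_ hgc
      exact continuous_matrix fun i j => continuous_id.matrix_elem _ _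
    -- Orthogonality leaves the determinant `±1`; connectedness and the value at `0` select `1`.
    have hsq : EqOn ((fun t => (g t).toBlocks₁₁.det) ^ 2) 1 (Icc 0 l) := by
      intro t ht
      have := congrArg Matrix.det (hblocks t ht).1
      rw [Matrix.det_mul, Matrix.det_transpose, Matrix.det_one, ← sq] at this
      exact this
    have hdet0 : (g 0).toBlocks₁₁.det = 1 := by
      rw [h0, ← Matrix.fromBlocks_one, Matrix.toBlocks_fromBlocks₁₁, Matrix.det_one]
    rcases isPreconnected_Icc.eq_one_or_eq_neg_one_of_sq_eq hc hsq with h | h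
    · exact h hs
    · have := h (⟨le_rfl, hs.1.trans hs.2⟩ : (0 : ℝ) ∈ Icc 0 l)
      simp only [hdet0, Pi.neg_apply, Pi.one_apply] at this
      norm_num at this
  refine ⟨(g s).toBlocks₁₁, ?_, fun i => g s (Sum.inl i) (Sum.inr ()), ?_⟩
  · rw [Matrix.mem_specialOrthogonalGroup_iff, Matrix.mem_orthogonalGroup_iff]
    exact ⟨(hblocks s hs).1, hdet⟩
  · conv_lhs => rw [← Matrix.fromBlocks_toBlocks (g s)]
    rw [(hblocks s hs).2, hcorner]
    rfl

/-! ### The statics equations as an autonomous system. -/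

namespace ContinuumRobot

variable {n : ℕ} (R : ContinuumRobot n)

theorem isUnit_det_stiffness : IsUnit R.stiffness.det := by
  have h1 := R.E_pos
  have h2 := R.G_pos
  have h3 := R.I_pos
  have h4 := R.J_pos
  have h5 := R.A_pos
  rw [isUnit_iff_ne_zero, stiffness, Matrix.det_diagonal]
  refine Finset.prod_ne_zero_iff.2 fun i _ => ?_
  rcases i with i | i <;> fin_cases i <;> simp <;> constructor <;> positivity

theorem stiffness_mulVec_inv (v : Vec6) : R.stiffness *ᵥ (R.stiffness⁻¹ *ᵥ v) = v := by
  rw [Matrix.mulVec_mulVec, Matrix.mul_nonsing_inv _ R.isUnit_det_stiffness, Matrix.one_mulVec]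

theorem stiffness_inv_mulVec (v : Vec6) : R.stiffness⁻¹ *ᵥ (R.stiffness *ᵥ v) = v := by
  rw [Matrix.mulVec_mulVec, Matrix.nonsing_inv_mul _ R.isUnit_det_stiffness, Matrix.one_mulVec]

/-- The statics equations as an autonomous equation for `(g, u, τ)` with `τ' = 0`. -/
noncomputable def staticsField (y : Mat4 × Vec6 × (Fin n → ℝ)) : Mat4 × Vec6 × (Fin n → ℝ) :=
  (y.1 * hat6 (R.ξ₀ + y.2.1),
    R.stiffness⁻¹ *ᵥ ((adMatrix (R.ξ₀ + y.2.1))ᵀ *ᵥ (R.stiffness *ᵥ y.2.1 + R.Λad y.2.2) -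
      potentialWrench R.U y.1), 0)

/-- The initial value of `(g, u, τ)` for the parameters `(λ, τ)`. -/
noncomputable def initialState (x : Vec6 × (Fin n → ℝ)) : Mat4 × Vec6 × (Fin n → ℝ) :=
  (1, R.stiffness⁻¹ *ᵥ x.1, x.2)

theorem contDiff_staticsField : ContDiff ℝ ∞ R.staticsField := by
  have hξ : ContDiff ℝ ∞ fun y : Mat4 × Vec6 × (Fin n → ℝ) => R.ξ₀ + y.2.1 :=
    contDiff_const.add contDiff_snd.fst
  have hΛ : ContDiff ℝ ∞ fun y : Mat4 × Vec6 × (Fin n → ℝ) =>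
      R.stiffness *ᵥ y.2.1 + R.Λad y.2.2 :=
    (contDiff_const.matrix_mulVec contDiff_snd.fst).add (R.Λad_smooth.comp contDiff_snd.snd)
  exact (contDiff_fst.matrix_mul (contDiff_hat6.comp hξ)).prodMk
    ((contDiff_const.matrix_mulVec (((contDiff_adMatrix.comp hξ).matrix_transpose.matrix_mulVec
      hΛ).sub ((contDiff_potentialWrench R.U_smooth).comp contDiff_fst))).prodMk contDiff_const)

theorem contDiff_initialState : ContDiff ℝ ∞ R.initialState :=
  contDiff_const.prodMk ((contDiff_const.matrix_mulVec contDiff_fst).prodMk contDiff_snd)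

/-- The state curve `(g, u, τ)` of a configuration. -/
noncomputable def stateCurve (τ : Fin n → ℝ) (q : R.Config) (s : ℝ) :
    Mat4 × Vec6 × (Fin n → ℝ) := (q.g s, q.u s, τ)

variable {R}

theorem IsShot.stateCurve_zero {x : Vec6 × (Fin n → ℝ)} {q : R.Config} (h : R.IsShot x q) :
    R.stateCurve x.2 q 0 = R.initialState x := by
  rw [stateCurve, initialState, h.2.1, ← h.1, stiffness_inv_mulVec]

theorem IsShot.hasDerivWithinAt_stateCurve {x : Vec6 × (Fin n → ℝ)} {q : R.Config}
    (h : R.IsShot x q) {s : ℝ} (hs : s ∈ Icc 0 R.l) :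
    HasDerivWithinAt (R.stateCurve x.2 q) (R.staticsField (R.stateCurve x.2 q s))
      (Icc 0 R.l) s := by
  obtain ⟨hg, hw⟩ := h.2.2 s hs
  -- `Λ_ad(τ)` is constant along the rod, so `u' = C⁻¹ Λ'`.
  have hu := (hw.sub_const (R.Λad x.2)).matrix_mulVec R.stiffness⁻¹
  simp only [wrench, add_sub_cancel_right, stiffness_inv_mulVec] at hu
  exact hg.prodMk (hu.prodMk (hasDerivWithinAt_const s _ x.2))

theorem IsShot.unique {x : Vec6 × (Fin n → ℝ)} {q r : R.Config} (hq : R.IsShot x q)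
    (hr : R.IsShot x r) : q = r := by
  have h := eqOn_of_hasDerivWithinAt_autonomous (R.contDiff_staticsField.of_le (by simp))
    (fun s hs => hq.hasDerivWithinAt_stateCurve hs)
    (fun s hs => hr.hasDerivWithinAt_stateCurve hs)
    (hq.stateCurve_zero.trans hr.stateCurve_zero.symm)
  refine ConfigSpace.ext_curve fun s hs => Prod.ext ?_ ?_
  · exact congrArg (fun y : Mat4 × Vec6 × (Fin n → ℝ) => y.1) (h hs)
  · exact congrArg (fun y : Mat4 × Vec6 × (Fin n → ℝ) => y.2.1) (h hs)

theorem isShot_Ψ {x : Vec6 × (Fin n → ℝ)} (hx : x ∈ R.shootingDomain) : R.IsShot x (R.Ψ x) :=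
  Classical.epsilon_spec hx

theorem IsShot.mem_shootingDomain {x : Vec6 × (Fin n → ℝ)} {q : R.Config} (h : R.IsShot x q) :
    x ∈ R.shootingDomain := ⟨q, h⟩

theorem IsShot.Ψ_eq {x : Vec6 × (Fin n → ℝ)} {q : R.Config} (h : R.IsShot x q) : R.Ψ x = q :=
  (isShot_Ψ h.mem_shootingDomain).unique h

/-- A solution of the autonomous equation with the right initial value is a shot. -/
theorem exists_isShot_of_hasDerivWithinAt {x : Vec6 × (Fin n → ℝ)}
    {β : ℝ → Mat4 × Vec6 × (Fin n → ℝ)} (h0 : β 0 = R.initialState x)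
    (hβ : ∀ s ∈ Icc 0 R.l, HasDerivWithinAt β (R.staticsField (β s)) (Icc 0 R.l) s) :
    ∃ q : R.Config, R.IsShot x q ∧ ∀ s ∈ Icc 0 R.l, q.curve s = ((β s).1, (β s).2.1) := by
  have hg : ∀ s ∈ Icc 0 R.l, HasDerivWithinAt (fun s => (β s).1)
      ((β s).1 * hat6 (R.ξ₀ + (β s).2.1)) (Icc 0 R.l) s := fun s hs =>
    (hβ s hs).fst
  have hu : ∀ s ∈ Icc 0 R.l, HasDerivWithinAt (fun s => (β s).2.1)
      (R.staticsField (β s)).2.1 (Icc 0 R.l) s := fun s hs =>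
    (hβ s hs).snd.fst
  have hτ : ∀ s ∈ Icc 0 R.l, (β s).2.2 = x.2 := by
    intro s hs
    have := eq_of_hasDerivWithinAt_Icc_zero (f := fun s => (β s).2.2)
      (fun t ht => (hβ t ht).snd.snd) hs
    rw [this, h0]
    rfl
  -- Bootstrapping: a solution of an equation with smooth right-hand side is smooth.
  have hsm : ContDiffOn ℝ ∞ β (Icc 0 R.l) :=
    ODE.contDiffOn_enat_Icc_of_hasDerivWithinAt (n := ⊤) (f := fun _ => R.staticsField)
      (u := univ) (R.contDiff_staticsField.comp contDiff_snd).contDiffOn hβ (fun _ _ => trivial)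
  have hpair : ∀ s ∈ Icc 0 R.l, IccExtend R.l_pos.le
      (fun t : Icc (0 : ℝ) R.l => ((β t).1, (β t).2.1)) s = ((β s).1, (β s).2.1) :=
    fun s hs => IccExtend_of_mem _ _ hs
  let q : R.Config := ⟨fun t => ((β t).1, (β t).2.1),
    (hsm.fst.prodMk hsm.snd.fst).congr hpair,
    fun s => mem_SE3_of_hasDerivWithinAt (congrArg Prod.fst h0) hg s.2⟩
  have hqg : ∀ s ∈ Icc 0 R.l, q.g s = (β s).1 := fun s hs => congrArg Prod.fst (hpair s hs)
  have hqu : ∀ s ∈ Icc 0 R.l, q.u s = (β s).2.1 := fun s hs => congrArg Prod.snd (hpair s hs)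
  have hl0 : (0 : ℝ) ∈ Icc 0 R.l := ⟨le_rfl, R.l_pos.le⟩
  refine ⟨q, ⟨?_, ?_, fun s hs => ⟨?_, ?_⟩⟩, hpair⟩
  · rw [hqu 0 hl0, h0, initialState, stiffness_mulVec_inv]
  · rw [hqg 0 hl0, h0, initialState]
  · rw [hqg s hs, hqu s hs]
    exact (hg s hs).congr_of_mem hqg hs
  · have h1 := (((hu s hs).congr_of_mem hqu hs).matrix_mulVec R.stiffness).add_const (R.Λad x.2)
    refine h1.congr_deriv ?_
    rw [staticsField, stiffness_mulVec_inv, wrench, hqg s hs, hqu s hs, hτ s hs]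

/-- The shooting map is defined and smooth near every point of its domain. -/
theorem exists_smoothFamilyOn_Ψ {x : Vec6 × (Fin n → ℝ)} (hx : x ∈ R.shootingDomain) :
    ∃ V : Set (Vec6 × (Fin n → ℝ)), IsOpen V ∧ x ∈ V ∧ V ⊆ R.shootingDomain ∧
      ConfigSpace.SmoothFamilyOn V R.Ψ := by
  have hshot := isShot_Ψ hx
  obtain ⟨V, G, hV, hxV, hG, hflow⟩ := exists_contDiffOn_flow R.contDiff_staticsField R.l_pos
    (fun s hs => hshot.hasDerivWithinAt_stateCurve hs)
  rw [hshot.stateCurve_zero] at hxV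
  have key : ∀ z ∈ R.initialState ⁻¹' V, z ∈ R.shootingDomain ∧ ∀ s ∈ Icc 0 R.l,
      (R.Ψ z).curve s = ((G (R.initialState z, s)).1, (G (R.initialState z, s)).2.1) := by
    intro z hz
    obtain ⟨q, hq, hqs⟩ := exists_isShot_of_hasDerivWithinAt (hflow _ hz).1 (hflow _ hz).2
    exact ⟨hq.mem_shootingDomain, by rwa [hq.Ψ_eq]⟩
  refine ⟨R.initialState ⁻¹' V, hV.preimage R.contDiff_initialState.continuous, hxV,
    fun z hz => (key z hz).1, ?_⟩
  have h1 : ContDiffOn ℝ ∞ (fun p : (Vec6 × (Fin n → ℝ)) × ℝ => G (R.initialState p.1, p.2))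
      ((R.initialState ⁻¹' V) ×ˢ Icc 0 R.l) :=
    hG.comp (f := fun p : (Vec6 × (Fin n → ℝ)) × ℝ => (R.initialState p.1, p.2))
      ((R.contDiff_initialState.comp contDiff_fst).prodMk contDiff_snd).contDiffOn
      fun p hp => ⟨hp.1, hp.2⟩
  exact (h1.fst.prodMk h1.snd.fst).congr fun p hp => (key p.1 hp.1).2 p.2 hp.2

/-! ### Recovering the parameters from the configuration. -/

theorem Ψ_mem_Cbar {x : Vec6 × (Fin n → ℝ)} (hx : x ∈ R.Abar) : R.Ψ x ∈ R.Cbar := by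
  have h := isShot_Ψ hx.1
  refine ⟨x.2, h.2, hx.2.1, ?_⟩
  rw [h.1]
  exact hx.2.2

theorem exists_Ψ_eq_of_mem_Cbar {q : R.Config} (hq : q ∈ R.Cbar) : ∃ x ∈ R.Abar, R.Ψ x = q := by
  obtain ⟨τ, hs, htip, hreg⟩ := hq
  have h : R.IsShot (R.stiffness *ᵥ q.u 0, τ) q := ⟨rfl, hs⟩
  refine ⟨_, ⟨h.mem_shootingDomain, ?_, hreg⟩, h.Ψ_eq⟩
  rw [F, h.Ψ_eq]
  exact htip

/-- The actuation wrench that a configuration needs to satisfy the tip condition. -/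
noncomputable def tipActuation (R : ContinuumRobot n) (q : R.Config) : Vec6 :=
  potentialWrench R.Utip (q.g R.l) - R.stiffness *ᵥ q.u R.l

theorem tipActuation_Ψ {x : Vec6 × (Fin n → ℝ)} (hx : x ∈ R.Abar) :
    R.tipActuation (R.Ψ x) = R.Λad x.2 := by
  have h := hx.2.1
  rw [F, wrench, sub_eq_zero] at h
  rw [tipActuation, ← h, add_sub_cancel_left]

theorem injOn_Ψ_Abar (hinj : Function.Injective R.Λad) : InjOn R.Ψ R.Abar := by
  intro x hx y hy h
  refine Prod.ext ?_ (hinj ?_)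
  · rw [← (isShot_Ψ hx.1).1, ← (isShot_Ψ hy.1).1, h]
  · rw [← tipActuation_Ψ hx, ← tipActuation_Ψ hy, h]

theorem contDiff_tipWrench_sub_stiffness : ContDiff ℝ ∞ fun z : Mat4 × Vec6 =>
    potentialWrench R.Utip z.1 - R.stiffness *ᵥ z.2 :=
  ((contDiff_potentialWrench R.Utip_smooth).comp contDiff_fst).sub
    (contDiff_const.matrix_mulVec contDiff_snd)

theorem continuous_tipActuation : Continuous R.tipActuation :=
  contDiff_tipWrench_sub_stiffness.continuous.comp
    (ConfigSpace.continuous_curve_apply ⟨R.l_pos.le, le_rfl⟩)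

/-- Near each point of the image, the inverse of the shooting map extends to a smooth and continuous
map on an open set of configurations. -/
theorem exists_smoothOn_leftInverse_Ψ (hemb : IsEmbedding R.Λad)
    (himm : ∀ τ : Fin n → ℝ, Function.Injective (fderiv ℝ R.Λad τ)) {x : Vec6 × (Fin n → ℝ)}
    (hx : x ∈ R.Abar) :
    ∃ (O : Set R.Config) (Φ : R.Config → Vec6 × (Fin n → ℝ)), IsOpen O ∧ R.Ψ x ∈ O ∧
      ConfigSpace.SmoothOn Φ O ∧ ContinuousOn Φ O ∧ ∀ y ∈ R.Abar, R.Ψ y ∈ O → Φ (R.Ψ y) = y := by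
  obtain ⟨N, ρ, hN, hxN, hρ, hleft⟩ :=
    exists_contDiffOn_leftInverse R.Λad_smooth hemb x.2 (himm x.2)
  have hl0 : (0 : ℝ) ∈ Icc 0 R.l := ⟨le_rfl, R.l_pos.le⟩
  have hll : R.l ∈ Icc 0 R.l := ⟨R.l_pos.le, le_rfl⟩
  have hC : ContDiff ℝ ∞ fun z : Mat4 × Vec6 => R.stiffness *ᵥ z.2 :=
    contDiff_const.matrix_mulVec contDiff_snd
  refine ⟨R.tipActuation ⁻¹' N, fun q => (R.stiffness *ᵥ q.u 0, ρ (R.tipActuation q)),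
    hN.preimage continuous_tipActuation, ?_, ?_, ?_, ?_⟩
  · rwa [mem_preimage, tipActuation_Ψ hx]
  · intro m V P _ hP hmaps
    exact (hC.comp_contDiffOn (hP.contDiffOn_curve_apply hl0)).prodMk
      (hρ.comp (contDiff_tipWrench_sub_stiffness.comp_contDiffOn (hP.contDiffOn_curve_apply hll))
        hmaps)
  -- Continuity is shown separately, since `SmoothOn` only tests finite-dimensional families.
  · exact (hC.continuous.comp (ConfigSpace.continuous_curve_apply hl0)).continuousOn.prodMk
      (hρ.continuousOn.comp continuous_tipActuation.continuousOn fun _ h => h)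
  · intro y hy hyO
    rw [mem_preimage, tipActuation_Ψ hy] at hyO
    refine Prod.ext (isShot_Ψ hy.1).1 ?_
    change ρ (R.tipActuation (R.Ψ y)) = y.2
    rw [tipActuation_Ψ hy, hleft _ hyO]

end ContinuumRobot

theorem lemma2 {n : ℕ} (R : ContinuumRobot n)
    (hemb : Topology.IsEmbedding R.Λad)
    (himm : ∀ τ : Fin n → ℝ, Function.Injective (fderiv ℝ R.Λad τ)) :
    ConfigSpace.IsDiffeomorphOn R.Ψ R.Abar R.Cbar := by
  have hbij : BijOn R.Ψ R.Abar R.Cbar :=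
    ⟨fun _ hx => ContinuumRobot.Ψ_mem_Cbar hx, ContinuumRobot.injOn_Ψ_Abar hemb.injective,
      fun _ hq => ContinuumRobot.exists_Ψ_eq_of_mem_Cbar hq⟩
  let e₀ : R.Abar ≃ R.Cbar := hbij.equiv R.Ψ
  have he : ∀ x : R.Abar, (e₀ x : R.Config) = R.Ψ x := fun _ => rfl
  have hsymm : ∀ r : R.Cbar, R.Ψ (e₀.symm r) = r := fun r => by
    rw [← he, Equiv.apply_symm_apply]
  have hcont : Continuous e₀ := by
    refine Continuous.subtype_mk (continuous_iff_continuousAt.2 fun x => ?_) _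
    obtain ⟨V, hV, hxV, -, hsm⟩ := ContinuumRobot.exists_smoothFamilyOn_Ψ x.2.1
    exact (hsm.continuousAt hV hxV).comp continuous_subtype_val.continuousAt
  have hcont_symm : Continuous e₀.symm := by
    -- Near each `q` the inverse coincides with a continuous local extension `Φ`.
    refine continuous_induced_rng.2 (continuous_iff_continuousAt.2 fun q => ?_)
    obtain ⟨O, Φ, hO, hqO, -, hΦ, hleft⟩ :=
      ContinuumRobot.exists_smoothOn_leftInverse_Ψ hemb himm (e₀.symm q).2
    rw [hsymm] at hqO
    have h1 : ContinuousAt (fun r : R.Cbar => Φ r) q :=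
      (hΦ.continuousAt (hO.mem_nhds hqO)).comp continuous_subtype_val.continuousAt
    refine h1.congr ?_
    filter_upwards [(hO.preimage continuous_subtype_val).mem_nhds hqO] with r hr
    have := hleft _ (e₀.symm r).2 (by rwa [hsymm])
    rwa [hsymm] at this
  refine ⟨⟨e₀, hcont, hcont_symm⟩, he, fun x => ?_, fun q => ?_⟩
  · obtain ⟨V, hV, hxV, -, hsm⟩ := ContinuumRobot.exists_smoothFamilyOn_Ψ x.2.1
    exact ⟨V, R.Ψ, hV, hxV, hsm, fun y _ => (he y).symm⟩
  · obtain ⟨O, Φ, hO, hqO, hΦ, -, hleft⟩ :=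
      ContinuumRobot.exists_smoothOn_leftInverse_Ψ hemb himm (e₀.symm q).2
    rw [hsymm] at hqO
    refine ⟨O, Φ, hO, hqO, hΦ, fun r hr => ?_⟩
    have := hleft _ (e₀.symm r).2 (by rwa [hsymm])
    rwa [hsymm] at this
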